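/- Let $n\in\mathbb N$, let $\Omega\subset\mathbb R^n$ be open, $1\le p\le\infty$, let $A:L^p(\Omega)\to L^p(\Omega)$ be a bounded linear operator (real-valued functions, Lebesgue measure), let $\alpha\in L^\infty(\Omega)$ satisfy $\alpha(x)\in[\alpha_0,1]$ for almost every $x\in\Omega$, where $\alpha_0>0$, and let $u_0\in L^p(\Omega)$. Then the Cauchy problem $$cD_t^{\alpha(x)}u(t,x)=Au(t,x),\qquad u(0,x)=u_0(x),$$ has a unique solution $u\in C([0,\infty);L^p(\Omega))$. Here, for $\beta:\Omega\to[0,1]$, $J_t^{\beta(x)}\varphi(t,x)=\frac1{\Gamma(\beta(x))}\int_0^t(t-s)^{\beta(x)-1}\varphi(s,x)\,ds$ if $\beta(x)>0$ and $J_t^{\beta(x)}\varphi(t,x)=\varphi(t,x)$ if $\beta(x)=0$, where a function in $C([0,\infty);L^p(\Omega))$ is evaluated through a jointly measurable representative; and $cD_t^{\alpha(x)}u(t,x)=\frac{d}{dt}J_t^{1-\alpha(x)}\big[u(t,x)-u(0,x)\big]$. A function $u\in C([0,\infty);L^p(\Omega))$ is a solution if $u(0)=u_0$ in $L^p(\Omega)$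 and if, for every $t\ge0$, the integral $J_t^{1-\alpha(x)}[u(t,x)-u(0,x)]$ converges absolutely for almost every $x$ (where $\alpha(x)<1$) and defines an element $V(t)$ of $L^p(\Omega)$, such that $V:[0,\infty)\to L^p(\Omega)$ is differentiable in the norm of $L^p(\Omega)$ (from the right at $t=0$) with $V'(t)=Au(t)$ for every $t\ge0$. -/

import Mathlib

open MeasureTheory Set
open scoped NNReal ENNReal

noncomputable section

namespace VariableOrder

/-- The integral in the Riemann-Liouville fractional integral of order `β x` of `φ` converges
(absolutely) at the point `(t, x)`. Nothing is required for order zero. -/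
def RLIntegralExists {X : Type*} (β : X → ℝ) (φ : ℝ → X → ℝ) (t : ℝ) (x : X) : Prop :=
  β x = 0 ∨ IntervalIntegrable (fun s : ℝ => (t - s) ^ (β x - 1) * φ s x) volume 0 t

open Classical in
/-- The Riemann-Liouville fractional integral of variable order `β x` in the variable `t`,
`J_t^{β(x)} φ (t, x) = (1 / Γ(β(x))) ∫₀ᵗ (t - s)^{β(x) - 1} φ(s, x) ds`,
and `J_t^{β(x)} φ (t, x) = φ (t, x)` if `β x = 0`. -/
def rlIntegral {X : Type*} (β : X → ℝ) (φ : ℝ → X → ℝ) (t : ℝ) (x : X) : ℝ :=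
  if β x = 0 then φ t x
  else (1 / Real.Gamma (β x)) * ∫ s in (0 : ℝ)..t, (t - s) ^ (β x - 1) * φ s x

/-- `φ` is a jointly measurable function of `(t, x)` representing the `L^p`-valued function `u`
on `[0, ∞)`: for every `t ≥ 0`, `φ (t, x) = u(t)(x)` for almost every `x`. -/
def IsRepresentative {X : Type*} [MeasurableSpace X] {μ : Measure X} {p : ℝ≥0∞}
    (u : ℝ≥0 → Lp ℝ p μ) (φ : ℝ → X → ℝ) : Prop :=
  Measurable (Function.uncurry φ) ∧ ∀ t : ℝ≥0, φ t =ᵐ[μ] u t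

/-- The `L^p`-valued function `u` on `[0, ∞)` has the Caputo fractional derivative `f` of variable
order `α x`, `cD_t^{α(x)} u (t, x) = d/dt J_t^{1 - α(x)} [u (t, x) - u (0, x)] = f (t, x)`,
for every `t ≥ 0` and almost every `x`.

The fractional integral `V t` is computed for almost every `x` from a jointly measurable
representative of `u` (the class of the result does not depend on the choice), and the derivative
`d/dt` is that of the `L^p`-valued function `V` on `[0, ∞)` (one-sided at `t = 0`). -/
def HasCaputoDeriv {X : Type*} [MeasurableSpace X] {μ : Measure X} {p : ℝ≥0∞} [Fact (1 ≤ p)]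
    (α : X → ℝ) (u f : ℝ≥0 → Lp ℝ p μ) : Prop :=
  ∃ (φ : ℝ → X → ℝ) (V : ℝ → Lp ℝ p μ),
    IsRepresentative u φ ∧
    (∀ t : ℝ≥0, ∀ᵐ x ∂μ,
      RLIntegralExists (fun y => 1 - α y) (fun s y => φ s y - φ 0 y) t x ∧
      V t x = rlIntegral (fun y => 1 - α y) (fun s y => φ s y - φ 0 y) t x) ∧
    ∀ t : ℝ≥0, HasDerivWithinAt V (f t) (Ici 0) (t : ℝ)

/-- `u ∈ C([0, ∞); L^p)` is a solution on `[0, ∞)` of the Cauchy problem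
`cD_t^{α(x)} u (t, x) = A u (t, x)`, `u (0, x) = u₀ x`. -/
def IsSolution {X : Type*} [MeasurableSpace X] {μ : Measure X} {p : ℝ≥0∞} [Fact (1 ≤ p)]
    (α : X → ℝ) (A : Lp ℝ p μ →L[ℝ] Lp ℝ p μ) (u₀ : Lp ℝ p μ) (u : C(ℝ≥0, Lp ℝ p μ)) : Prop :=
  HasCaputoDeriv α u (fun t => A (u t)) ∧ u 0 = u₀

end VariableOrder

end

/-! The kernels `k_a(r) = r ^ (a - 1) / Γ(a)` form a convolution semigroup, `k_a * k_b = k_(a+b)`.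
Applying `J^α` to `J^(1-α)[u - u₀] = ∫₀ᵗ A u` therefore turns the Cauchy problem into the Volterra
equation `u(t) = u₀ + ∫₀ᵗ k_α(r) A u(t - r) dr`. As `A` need not commute with multiplication by
`k_α(r)`, this is solved in `L^p`, not for each `x`. The operator kernel is norm continuous on `(0,
∞)` and bounded by `C (r ^ (a₀ - 1) + 1)`, so a weight `exp (-c r)` with large `c` brings its
integral below `1/2` and Banach's fixed point theorem applies (`volterra_exists`,
`volterra_unique`).

The equivalence is `hasCaputoDeriv_of_volterra` and `eq_add_volterraConv_of_hasCaputoDeriv`. Both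
use the scalar semigroup law `rlInt_rlInt` for almost every `x`; `integral_Lp_ae_eq` transfers it to
Bochner integrals through jointly measurable representatives. -/

namespace VariableOrder

/-! ### The scalar Riemann-Liouville kernel -/

/-- The Riemann-Liouville kernel `r ^ (a - 1) / Γ a`, extended by zero to `r ≤ 0`. -/
noncomputable def rlKernel (a r : ℝ) : ℝ :=
  (Ioi (0 : ℝ)).indicator (fun r => r ^ (a - 1) / Real.Gamma a) r

theorem rlKernel_of_pos (a : ℝ) {r : ℝ} (hr : 0 < r) :
    rlKernel a r = r ^ (a - 1) / Real.Gamma a :=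
  indicator_of_mem (mem_Ioi.2 hr) _

theorem rlKernel_of_nonpos (a : ℝ) {r : ℝ} (hr : r ≤ 0) : rlKernel a r = 0 :=
  indicator_of_notMem (by simpa using hr) _

theorem rlKernel_nonneg {a : ℝ} (ha : 0 < a) (r : ℝ) : 0 ≤ rlKernel a r := by
  rcases lt_or_ge 0 r with hr | hr
  · rw [rlKernel_of_pos a hr]
    have := Real.Gamma_pos_of_pos ha
    positivity
  · rw [rlKernel_of_nonpos a hr]

theorem rlKernel_one_of_pos {r : ℝ} (hr : 0 < r) : rlKernel 1 r = 1 := by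
  simp [rlKernel_of_pos 1 hr]

theorem measurable_rlKernel (a : ℝ) : Measurable (rlKernel a) :=
  Measurable.indicator (by fun_prop) measurableSet_Ioi

/-- This is Euler's Beta integral; on `[0, x]` the bases are nonnegative, so the complex powers are
real. -/
theorem integral_rpow_mul_sub_rpow {a b x : ℝ} (ha : 0 < a) (hb : 0 < b) (hx : 0 < x) :
    ∫ s in (0 : ℝ)..x, s ^ (b - 1) * (x - s) ^ (a - 1) =
      x ^ (a + b - 1) * (Real.Gamma a * Real.Gamma b / Real.Gamma (a + b)) := by
  have h1 := Complex.betaIntegral_scaled (b : ℂ) (a : ℂ) hx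
  have h2 := Complex.Gamma_mul_Gamma_eq_betaIntegral (s := (b : ℂ)) (t := (a : ℂ))
    (by simpa using hb) (by simpa using ha)
  have h3 : Complex.Gamma ((b : ℂ) + a) ≠ 0 :=
    Complex.Gamma_ne_zero_of_re_pos (by simpa using add_pos hb ha)
  have h4 : Complex.betaIntegral b a =
      ((Real.Gamma a * Real.Gamma b / Real.Gamma (a + b) : ℝ) : ℂ) := by
    rw [Complex.ofReal_div, Complex.ofReal_mul, ← Complex.Gamma_ofReal, ← Complex.Gamma_ofReal,
      ← Complex.Gamma_ofReal, Complex.ofReal_add, add_comm (a : ℂ), eq_div_iff h3,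
      mul_comm (Complex.Gamma a), h2, mul_comm]
  rw [h4] at h1
  have h5 : ∫ s in (0 : ℝ)..x, (s : ℂ) ^ ((b : ℂ) - 1) * ((x : ℂ) - s) ^ ((a : ℂ) - 1) =
      ((∫ s in (0 : ℝ)..x, s ^ (b - 1) * (x - s) ^ (a - 1) : ℝ) : ℂ) := by
    rw [← intervalIntegral.integral_ofReal]
    refine intervalIntegral.integral_congr fun s hs => ?_
    rw [uIcc_of_le hx.le] at hs
    rw [Complex.ofReal_mul, Complex.ofReal_cpow hs.1, Complex.ofReal_cpow (sub_nonneg.2 hs.2)]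
    push_cast
    rfl
  rw [h5] at h1
  have h6 : (x : ℂ) ^ ((b : ℂ) + a - 1) = ((x ^ (a + b - 1) : ℝ) : ℂ) := by
    rw [Complex.ofReal_cpow hx.le]
    push_cast
    rw [add_comm (b : ℂ)]
  rw [h6] at h1
  exact_mod_cast h1

theorem rlKernel_convolution_zero {a b : ℝ} (ha : 0 < a) (hb : 0 < b) (x : ℝ) :
    Integrable (fun s => rlKernel a (x - s) * rlKernel b s) ∧
      ∫ s, rlKernel a (x - s) * rlKernel b s = rlKernel (a + b) x := by
  have hga := Real.Gamma_pos_of_pos ha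
  have hgb := Real.Gamma_pos_of_pos hb
  have hgab := Real.Gamma_pos_of_pos (add_pos ha hb)
  rcases lt_or_ge 0 x with hx | hx
  · have hfun : (fun s => rlKernel a (x - s) * rlKernel b s) =
        (Ioo 0 x).indicator (fun s => (s ^ (b - 1) * (x - s) ^ (a - 1)) *
          (Real.Gamma a * Real.Gamma b)⁻¹) := by
      ext s
      by_cases hs : s ∈ Ioo 0 x
      · rw [indicator_of_mem hs, rlKernel_of_pos _ (sub_pos.2 hs.2), rlKernel_of_pos _ hs.1]
        field_simp
      · rw [indicator_of_notMem hs]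
        rcases le_or_gt s 0 with h | h
        · rw [rlKernel_of_nonpos b h, mul_zero]
        · have : x ≤ s := by
            by_contra h'
            exact hs ⟨h, not_le.1 h'⟩
          rw [rlKernel_of_nonpos a (sub_nonpos.2 this), zero_mul]
    have hint : ∫ s, rlKernel a (x - s) * rlKernel b s = rlKernel (a + b) x := by
      rw [hfun, integral_indicator measurableSet_Ioo, integral_mul_const,
        ← integral_Ioc_eq_integral_Ioo, ← intervalIntegral.integral_of_le hx.le,
        integral_rpow_mul_sub_rpow ha hb hx, rlKernel_of_pos _ hx]
      field_simp
    refine ⟨?_, hint⟩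
    -- A non-integrable function has integral `0` by convention, but the value found is positive.
    by_contra h
    rw [integral_undef h, rlKernel_of_pos _ hx] at hint
    have : 0 < x ^ (a + b - 1) / Real.Gamma (a + b) := by positivity
    exact this.ne hint
  · have hfun : (fun s => rlKernel a (x - s) * rlKernel b s) = 0 := by
      ext s
      rcases le_or_gt s 0 with h | h
      · simp [rlKernel_of_nonpos b h]
      · simp [rlKernel_of_nonpos a (by linarith : x - s ≤ 0)]
    rw [hfun, rlKernel_of_nonpos _ hx]
    exact ⟨integrable_zero _ _ _, by simp⟩

theorem rlKernel_convolution {a b : ℝ} (ha : 0 < a) (hb : 0 < b) (t r : ℝ) :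
    Integrable (fun s => rlKernel a (t - s) * rlKernel b (s - r)) ∧
      ∫ s, rlKernel a (t - s) * rlKernel b (s - r) = rlKernel (a + b) (t - r) := by
  obtain ⟨h1, h2⟩ := rlKernel_convolution_zero ha hb (t - r)
  have : (fun s => rlKernel a (t - s) * rlKernel b (s - r)) =
      fun s => (fun s => rlKernel a (t - r - s) * rlKernel b s) (s - r) := by
    ext s
    simp only
    congr 2
    ring
  rw [this]
  refine ⟨h1.comp_sub_right r, ?_⟩
  rw [integral_sub_right_eq_self (fun s => rlKernel a (t - r - s) * rlKernel b s) r, h2]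

/-- The scalar Riemann-Liouville integral of order `a > 0`. -/
noncomputable def rlInt (a : ℝ) (f : ℝ → ℝ) (t : ℝ) : ℝ :=
  ∫ s in (0 : ℝ)..t, rlKernel a (t - s) * f s

theorem rlInt_eq_integral {a : ℝ} (f : ℝ → ℝ) {s T : ℝ} (hs : 0 ≤ s) (hsT : s ≤ T) :
    rlInt a f s = ∫ r in Ioc 0 T, rlKernel a (s - r) * f r := by
  rw [rlInt, intervalIntegral.integral_of_le hs]
  refine (setIntegral_eq_of_subset_of_forall_sdiff_eq_zero measurableSet_Ioc
    (Ioc_subset_Ioc_right hsT) fun r hr => ?_).symm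
  have : s ≤ r := by
    by_contra h
    exact hr.2 ⟨hr.1.1, (not_le.1 h).le⟩
  rw [rlKernel_of_nonpos _ (sub_nonpos.2 this), zero_mul]

theorem rlInt_one (f : ℝ → ℝ) {t : ℝ} (ht : 0 ≤ t) : rlInt 1 f t = ∫ s in (0 : ℝ)..t, f s := by
  rw [rlInt, intervalIntegral.integral_of_le ht, intervalIntegral.integral_of_le ht,
    integral_Ioc_eq_integral_Ioo, integral_Ioc_eq_integral_Ioo]
  refine setIntegral_congr_fun measurableSet_Ioo fun s hs => ?_
  simp [rlKernel_one_of_pos (sub_pos.2 hs.2)]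

theorem rlKernel_le {a : ℝ} (ha : 1 ≤ a) {T r : ℝ} (hr : r ≤ T) (hT : 0 ≤ T) :
    rlKernel a r ≤ T ^ (a - 1) / Real.Gamma a := by
  have := Real.Gamma_pos_of_pos (by linarith : 0 < a)
  rcases lt_or_ge 0 r with h | h
  · rw [rlKernel_of_pos _ h]
    gcongr
  · rw [rlKernel_of_nonpos _ h]
    positivity

/-- The semigroup law of the scalar Riemann-Liouville integral for integrable functions, when the
orders add up to at least one. -/
theorem rlInt_rlInt {a b T : ℝ} (ha : 0 < a) (hb : 0 < b) (hab : 1 ≤ a + b) (hT : 0 ≤ T)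
    {f : ℝ → ℝ} (hf : IntervalIntegrable f volume 0 T) :
    IntervalIntegrable (fun s => rlKernel a (T - s) * rlInt b f s) volume 0 T ∧
      rlInt a (rlInt b f) T = rlInt (a + b) f T := by
  rw [intervalIntegrable_iff_integrableOn_Ioc_of_le hT] at hf ⊢
  -- Tonelli with `s` integrated first over the whole line: this leaves `k_(a+b)(T - r) |f r|`, and
  -- `1 ≤ a + b` makes the kernel factor bounded, so integrability of `f` suffices.
  have hF : Integrable (Function.uncurry fun s r =>
      rlKernel a (T - s) * (rlKernel b (s - r) * f r))
      ((volume : Measure ℝ).prod (volume.restrict (Ioc 0 T))) := by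
    have hmeas : AEStronglyMeasurable (Function.uncurry fun s r =>
        rlKernel a (T - s) * (rlKernel b (s - r) * f r))
        ((volume : Measure ℝ).prod (volume.restrict (Ioc 0 T))) := by
      refine AEStronglyMeasurable.mul ?_ (AEStronglyMeasurable.mul ?_ ?_)
      · exact ((measurable_rlKernel a).comp (by fun_prop)).aestronglyMeasurable
      · exact ((measurable_rlKernel b).comp (by fun_prop)).aestronglyMeasurable
      · exact hf.aestronglyMeasurable.comp_snd
    rw [integrable_prod_iff' hmeas]
    have hcalc : ∀ r, ∫ s, ‖rlKernel a (T - s) * (rlKernel b (s - r) * f r)‖ =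
        rlKernel (a + b) (T - r) * ‖f r‖ := by
      intro r
      rw [← (rlKernel_convolution ha hb T r).2, ← integral_mul_const]
      congr 1 with s
      rw [norm_mul, norm_mul, Real.norm_of_nonneg (rlKernel_nonneg ha _),
        Real.norm_of_nonneg (rlKernel_nonneg hb _), mul_assoc]
    refine ⟨Filter.Eventually.of_forall fun r => ?_, ?_⟩
    · simp only [Function.uncurry_apply_pair, ← mul_assoc]
      exact (rlKernel_convolution ha hb T r).1.mul_const _
    · simp only [Function.uncurry_apply_pair, hcalc]
      refine Integrable.bdd_mul (c := T ^ (a + b - 1) / Real.Gamma (a + b)) hf.norm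
        ((measurable_rlKernel _).comp (by fun_prop)).aestronglyMeasurable ?_
      filter_upwards [ae_restrict_mem measurableSet_Ioc] with r hr
      rw [Real.norm_of_nonneg (rlKernel_nonneg (add_pos ha hb) _)]
      exact rlKernel_le hab (by linarith [hr.1]) hT
  have hinner : ∀ s ∈ Ioc 0 T, rlKernel a (T - s) * rlInt b f s =
      ∫ r in Ioc 0 T, rlKernel a (T - s) * (rlKernel b (s - r) * f r) := by
    intro s hs
    rw [integral_const_mul, rlInt_eq_integral f hs.1.le hs.2]
  refine ⟨(hF.integral_prod_left.integrableOn (s := Ioc 0 T)).congr_fun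
    (fun s hs => (hinner s hs).symm) measurableSet_Ioc, ?_⟩
  rw [rlInt, intervalIntegral.integral_of_le hT, setIntegral_congr_fun measurableSet_Ioc hinner,
    setIntegral_eq_integral_of_forall_compl_eq_zero, integral_integral_swap hF,
    rlInt_eq_integral f hT le_rfl]
  · congr 1 with r
    rw [← (rlKernel_convolution ha hb T r).2, ← integral_mul_const]
    simp only [mul_assoc]
  · intro s hs
    refine setIntegral_eq_zero_of_forall_eq_zero fun r hr => ?_
    rcases le_or_gt s 0 with h | h
    · rw [rlKernel_of_nonpos b (by linarith [hr.1] : s - r ≤ 0)]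
      simp
    · rw [rlKernel_of_nonpos a (sub_nonpos.2 (not_lt.1 fun h' => hs ⟨h, h'.le⟩)), zero_mul]

/-! ### Jointly measurable representatives of `L^p`-valued functions -/

section Representatives

variable {X : Type*} [MeasurableSpace X] {μ : Measure X} {p : ℝ≥0∞} [Fact (1 ≤ p)]

/-- A sequence in `L^p` that converges with geometric rate converges almost everywhere. -/
theorem ae_tendsto_of_dist_le_geometric {f : ℕ → Lp ℝ p μ} {g : Lp ℝ p μ}
    (h : ∀ k, dist (g) (f k) < (1 / 2) ^ k) :
    ∀ᵐ x ∂μ, Filter.Tendsto (fun k => f k x) Filter.atTop (nhds (g x)) := by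
  have hcauchy : ∀ᵐ x ∂μ, ∃ l : ℝ, Filter.Tendsto (fun k => f k x) Filter.atTop (nhds l) := by
    refine Lp.ae_tendsto_of_cauchy_eLpNorm (p := p) (B := fun k => ENNReal.ofReal (2 * (1 / 2) ^ k))
      (fun n => Lp.aestronglyMeasurable _) Fact.out ?_ ?_
    · exact ((summable_geometric_two.mul_left 2).tsum_ofReal_ne_top)
    · intro N n m hn hm
      rw [← Lp.edist_def, edist_dist]
      refine (ENNReal.ofReal_lt_ofReal_iff (by positivity)).2 ?_
      have h1 : ((1 : ℝ) / 2) ^ n ≤ (1 / 2) ^ N :=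
        pow_le_pow_of_le_one (by norm_num) (by norm_num) hn
      have h2 : ((1 : ℝ) / 2) ^ m ≤ (1 / 2) ^ N :=
        pow_le_pow_of_le_one (by norm_num) (by norm_num) hm
      have h3 := dist_triangle_left (f n) (f m) g
      linarith [h n, h m]
  have hlim : Filter.Tendsto f Filter.atTop (nhds g) := by
    rw [tendsto_iff_dist_tendsto_zero]
    refine squeeze_zero (fun _ => dist_nonneg) (fun k => ?_)
      (tendsto_pow_atTop_nhds_zero_of_lt_one (r := (1 / 2 : ℝ)) (by norm_num) (by norm_num))
    rw [dist_comm]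
    exact (h k).le
  -- A subsequence tends to `g` almost everywhere, which identifies the pointwise limit.
  obtain ⟨φ, hφ, hφlim⟩ := (tendstoInMeasure_of_tendsto_Lp hlim).exists_seq_tendsto_ae
  filter_upwards [hcauchy, hφlim] with x hx1 hx2
  obtain ⟨l, hl⟩ := hx1
  rwa [tendsto_nhds_unique hx2 (hl.comp hφ.tendsto_atTop)]

open Classical in
/-- A continuous `L^p`-valued function has a jointly measurable representative. -/
theorem exists_measurable_representative {G : ℝ → Lp ℝ p μ} (hG : Continuous G) :
    ∃ γ : ℝ → X → ℝ, Measurable (Function.uncurry γ) ∧ ∀ t, γ t =ᵐ[μ] G t := by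
  let q := TopologicalSpace.denseSeq ℝ
  have hex : ∀ (k : ℕ) (t : ℝ), ∃ j, dist (G t) (G (q j)) < (1 / 2) ^ k := by
    intro k t
    have hopen : IsOpen {s | dist (G t) (G s) < (1 / 2) ^ k} :=
      isOpen_lt (by fun_prop) (by fun_prop)
    exact (TopologicalSpace.denseRange_denseSeq ℝ).exists_mem_open hopen
      ⟨t, by simp⟩
  -- Replacing `G t` by its value at the first sufficiently close dense point gives countably many
  -- slices, hence a jointly measurable approximation.
  let J : ℕ → ℝ → ℕ := fun k t => Nat.find (hex k t)
  have hJ : ∀ k, Measurable (J k) := fun k =>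
    measurable_find (hex k) fun j => (isOpen_lt (by fun_prop) (by fun_prop)).measurableSet
  let γ : ℕ → ℝ × X → ℝ := fun k z => G (q (J k z.1)) z.2
  have hγ : ∀ k, Measurable (γ k) := by
    intro k
    have h1 : Measurable (fun z : ℕ × X => G (q z.1) z.2) :=
      measurable_from_prod_countable_right fun j =>
      (Lp.stronglyMeasurable (G (q j))).measurable
    exact h1.comp (((hJ k).comp measurable_fst).prodMk measurable_snd)
  refine ⟨fun t x => Filter.limsup (fun k => γ k (t, x)) Filter.atTop, Measurable.limsup hγ, ?_⟩
  intro t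
  filter_upwards [ae_tendsto_of_dist_le_geometric fun k => Nat.find_spec (hex k t)] with x hx
  exact hx.limsup_eq

/-- On a set of finite measure, functions in `L^p` are integrable. -/
noncomputable def toL1Restrict (p : ℝ≥0∞) [Fact (1 ≤ p)] (E : Set X) (hE : μ E < ∞) :
    Lp ℝ p μ →L[ℝ] Lp ℝ 1 (μ.restrict E) :=
  haveI : IsFiniteMeasure (μ.restrict E) := ⟨by simpa using hE⟩
  LinearMap.mkContinuous
    { toFun := fun h => MemLp.toLp h (((Lp.memLp h).restrict E).mono_exponent Fact.out)
      map_add' := fun h k => by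
        rw [← MemLp.toLp_add]
        exact MemLp.toLp_congr _ _ (ae_restrict_of_ae (Lp.coeFn_add h k))
      map_smul' := fun c h => by
        rw [RingHom.id_apply, ← MemLp.toLp_const_smul]
        exact MemLp.toLp_congr _ _ (ae_restrict_of_ae (Lp.coeFn_smul c h)) }
    ((μ.restrict E univ ^ (1 / (1 : ℝ≥0∞).toReal - 1 / p.toReal)).toReal) fun h => by
      have hfin : μ.restrict E univ ^ (1 / (1 : ℝ≥0∞).toReal - 1 / p.toReal) ≠ ∞ := by
        refine ENNReal.rpow_ne_top_of_nonneg ?_ (measure_ne_top _ _)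
        -- For `p = ∞`, `p.toReal = 0` and `1 / 0 = 0`, so the exponent is `1`.
        rcases eq_or_ne p ∞ with hp | hp
        · simp [hp]
        · have : 1 ≤ p.toReal := by
            rw [← ENNReal.toReal_one]
            exact ENNReal.toReal_mono hp Fact.out
          rw [ENNReal.toReal_one, sub_nonneg]
          exact one_div_le_one_div_of_le one_pos this
      have hle := eLpNorm_le_eLpNorm_mul_rpow_measure_univ (μ := μ.restrict E) (p := 1) (q := p)
        Fact.out (Lp.aestronglyMeasurable h).restrict
      have hle' : eLpNorm h p (μ.restrict E) ≤ eLpNorm h p μ :=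
        eLpNorm_mono_measure _ Measure.restrict_le_self
      rw [LinearMap.coe_mk, AddHom.coe_mk, Lp.norm_toLp, Lp.norm_def, ← ENNReal.toReal_mul,
        mul_comm]
      exact ENNReal.toReal_mono (ENNReal.mul_ne_top (Lp.eLpNorm_ne_top h) hfin)
        (hle.trans (mul_le_mul_left hle' _))

theorem coeFn_toL1Restrict {E : Set X} (hE : μ E < ∞) (h : Lp ℝ p μ) :
    toL1Restrict p E hE h =ᵐ[μ.restrict E] h :=
  haveI : IsFiniteMeasure (μ.restrict E) := ⟨by simpa using hE⟩
  MemLp.coeFn_toLp (((Lp.memLp h).restrict E).mono_exponent Fact.out)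

/-- The Bochner integral of an `L^p`-valued function can be computed pointwise from a jointly
measurable representative. -/
theorem integral_Lp_ae_eq [SigmaFinite μ] {ν : Measure ℝ} [SFinite ν] {G : ℝ → Lp ℝ p μ}
    (hG : Integrable G ν) {γ : ℝ → X → ℝ} (hγ : Measurable (Function.uncurry γ))
    (hγG : ∀ᵐ s ∂ν, γ s =ᵐ[μ] G s) :
    ∀ᵐ x ∂μ, Integrable (fun s => γ s x) ν ∧ (∫ s, G s ∂ν : Lp ℝ p μ) x = ∫ s, γ s x ∂ν := by
  -- On sets of finite measure `L^p` embeds in `L^1`, where Fubini is available for every `p`,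
  -- including `∞`.
  have hprod : ∀ E, MeasurableSet E → μ E < ∞ →
      Integrable (Function.uncurry γ) (ν.prod (μ.restrict E)) := by
    intro E hEm hE
    have h1 := (toL1Restrict p E hE).integrable_comp hG
    have h2 : ∀ᵐ s ∂ν, γ s =ᵐ[μ.restrict E] toL1Restrict p E hE (G s) := by
      filter_upwards [hγG] with s hs
      have hs' : γ s =ᵐ[μ.restrict E] G s := ae_restrict_of_ae hs
      exact hs'.trans (coeFn_toL1Restrict hE _).symm
    rw [integrable_prod_iff hγ.aestronglyMeasurable]
    constructor
    · filter_upwards [h2] with s hs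
      exact (L1.integrable_coeFn _).congr hs.symm
    · refine h1.norm.congr ?_
      filter_upwards [h2] with s hs
      rw [L1.norm_eq_integral_norm]
      refine integral_congr_ae ?_
      filter_upwards [hs] with x hx
      rw [← hx]
      rfl
  have hint : ∀ᵐ x ∂μ, Integrable (fun s => γ s x) ν := by
    refine ae_of_forall_measure_lt_top_ae_restrict _ fun E hEm hE => ?_
    exact (hprod E hEm hE).prod_left_ae
  have heq : (∫ s, G s ∂ν : Lp ℝ p μ) =ᵐ[μ] fun x => ∫ s, γ s x ∂ν := by
    refine ae_eq_of_forall_setIntegral_eq_of_sigmaFinite ?_ ?_ ?_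
    · intro E hEm hE
      exact (L1.integrable_coeFn (toL1Restrict p E hE (∫ s, G s ∂ν))).congr
        (coeFn_toL1Restrict hE _)
    · intro E hEm hE
      exact (hprod E hEm hE).integral_prod_right
    · intro E hEm hE
      -- Integration over `E` is a continuous functional, so it commutes with the Bochner integral.
      let I : Lp ℝ p μ →L[ℝ] ℝ := (L1.integralCLM (E := ℝ)).comp (toL1Restrict p E hE)
      have hI : ∀ h, I h = ∫ x in E, h x ∂μ := by
        intro h
        rw [← integral_congr_ae (coeFn_toL1Restrict hE h), ← L1.integral_eq_integral]
        exact (L1.integral_eq _).symm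
      rw [← integral_integral_swap (hprod E hEm hE), ← hI, ← I.integral_comp_comm hG]
      refine integral_congr_ae ?_
      filter_upwards [hγG] with s hs
      rw [hI]
      exact integral_congr_ae (ae_restrict_of_ae hs.symm)
  filter_upwards [hint, heq] with x h1 h2 using ⟨h1, h2⟩

end Representatives

/-! ### Volterra equations of convolution type in a Banach space -/

section Volterra

variable {E : Type*} [NormedAddCommGroup E] [NormedSpace ℝ E]

/-- The convolution of an operator-valued kernel on `(0, ∞)` with a function on `[0, ∞)`. -/
noncomputable def volterraConv (K : ℝ → E →L[ℝ] E) (f : ℝ → E) (t : ℝ) : E :=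
  ∫ r in Ioc 0 t, K r (f (t - r))

variable {K : ℝ → E →L[ℝ] E}

theorem aestronglyMeasurable_volterra (hK : ContinuousOn K (Ioi 0)) {f : ℝ → E}
    (hf : Continuous f) (t : ℝ) :
    AEStronglyMeasurable (fun r => K r (f (t - r))) (volume.restrict (Ioc 0 t)) :=
  ContinuousOn.aestronglyMeasurable ((hK.mono Ioc_subset_Ioi_self).clm_apply (by fun_prop))
    measurableSet_Ioc

theorem integrableOn_volterra (hK : ContinuousOn K (Ioi 0))
    (hKint : ∀ T, IntegrableOn K (Ioc 0 T)) {f : ℝ → E} (hf : Continuous f) (t : ℝ) :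
    IntegrableOn (fun r => K r (f (t - r))) (Ioc 0 t) := by
  obtain ⟨C, hC⟩ := isCompact_Icc.exists_bound_of_continuousOn (s := Icc 0 t)
    (f := fun r => f (t - r)) (by fun_prop)
  refine Integrable.mono' ((hKint t).norm.mul_const C) (aestronglyMeasurable_volterra hK hf t) ?_
  filter_upwards [ae_restrict_mem measurableSet_Ioc] with r hr
  exact ((K r).le_opNorm _).trans
    (mul_le_mul_of_nonneg_left (hC r (Ioc_subset_Icc_self hr)) (norm_nonneg _))

theorem volterraConv_sub (hK : ContinuousOn K (Ioi 0)) (hKint : ∀ T, IntegrableOn K (Ioc 0 T))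
    {f g : ℝ → E} (hf : Continuous f) (hg : Continuous g) (t : ℝ) :
    volterraConv K (fun s => f s - g s) t = volterraConv K f t - volterraConv K g t := by
  simp only [volterraConv, map_sub]
  exact integral_sub (integrableOn_volterra hK hKint hf t) (integrableOn_volterra hK hKint hg t)

theorem norm_volterraConv_le (hKint : IntegrableOn K (Ioi 0)) {f : ℝ → E} {t C : ℝ}
    (hC : ∀ s ∈ Icc 0 t, ‖f s‖ ≤ C) (hC0 : 0 ≤ C) :
    ‖volterraConv K f t‖ ≤ (∫ r in Ioi 0, ‖K r‖) * C := by
  have h1 : ‖volterraConv K f t‖ ≤ ∫ r in Ioc 0 t, ‖K r‖ * C := by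
    refine norm_integral_le_of_norm_le
      (((hKint.mono_set Ioc_subset_Ioi_self).norm).mul_const C) ?_
    filter_upwards [ae_restrict_mem measurableSet_Ioc] with r hr
    exact ((K r).le_opNorm _).trans (mul_le_mul_of_nonneg_left
      (hC _ ⟨sub_nonneg.2 hr.2, by linarith [hr.1]⟩) (norm_nonneg _))
  rw [integral_mul_const] at h1
  refine h1.trans (mul_le_mul_of_nonneg_right ?_ hC0)
  exact setIntegral_mono_set hKint.norm (Filter.Eventually.of_forall fun r => norm_nonneg _)
    Ioc_subset_Ioi_self.eventuallyLE

theorem continuous_volterraConv (hK : ContinuousOn K (Ioi 0))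
    (hKint : ∀ T, IntegrableOn K (Ioc 0 T)) {f : ℝ → E} (hf : Continuous f) :
    Continuous (volterraConv K f) := by
  rw [continuous_iff_continuousAt]
  intro t₀
  obtain ⟨C, hC⟩ := isCompact_Icc.exists_bound_of_continuousOn (s := Icc 0 (t₀ + 1))
    (f := f) (by fun_prop)
  have heq : volterraConv K f =
      fun t => ∫ r, (Ioc 0 t).indicator (fun r => K r (f (t - r))) r := by
    ext1 t
    rw [integral_indicator measurableSet_Ioc, volterraConv]
  have hlt : ∀ᶠ t in nhds t₀, t < t₀ + 1 := eventually_lt_nhds (by linarith)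
  rw [heq]
  refine continuousAt_of_dominated
    (bound := (Ioc 0 (t₀ + 1)).indicator fun r => ‖K r‖ * C) ?_ ?_ ?_ ?_
  · exact Filter.Eventually.of_forall fun t => (aestronglyMeasurable_indicator_iff
      measurableSet_Ioc).2 (aestronglyMeasurable_volterra hK hf t)
  · filter_upwards [hlt] with t ht
    refine Filter.Eventually.of_forall fun r => ?_
    by_cases hr : r ∈ Ioc 0 t
    · rw [indicator_of_mem hr, indicator_of_mem (Ioc_subset_Ioc_right ht.le hr)]
      exact ((K r).le_opNorm _).trans (mul_le_mul_of_nonneg_left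
        (hC _ ⟨sub_nonneg.2 hr.2, by linarith [hr.1]⟩) (norm_nonneg _))
    · rw [indicator_of_notMem hr, norm_zero]
      refine indicator_nonneg (fun s hs => mul_nonneg (norm_nonneg _) ?_) r
      exact (norm_nonneg _).trans (hC s (Ioc_subset_Icc_self hs))
  · exact (integrable_indicator_iff measurableSet_Ioc).2 ((hKint _).norm.mul_const C)
  -- The moving endpoint of `Ioc 0 t` causes a jump at `t₀` only for `r = t₀`, a null set.
  · filter_upwards [Measure.ae_ne volume t₀] with r hr
    rcases le_or_gt r 0 with h0 | h0
    · have : (fun t => (Ioc 0 t).indicator (fun r => K r (f (t - r))) r) = fun _ => 0 := by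
        ext1 t
        exact indicator_of_notMem (fun h => h0.not_gt h.1) _
      rw [this]
      exact continuousAt_const
    rcases lt_or_gt_of_ne hr with h1 | h1
    · have hcont : ContinuousAt (fun t => K r (f (t - r))) t₀ := by fun_prop
      refine hcont.congr ?_
      filter_upwards [lt_mem_nhds h1] with t ht
      rw [indicator_of_mem (show r ∈ Ioc 0 t from ⟨h0, le_of_lt ht⟩)]
    · refine (continuousAt_const (y := (0 : E))).congr ?_
      filter_upwards [gt_mem_nhds h1] with t ht
      rw [indicator_of_notMem fun h => (not_le.2 ht) h.2]

/-- The affine map is a contraction of ratio `1/2` in the sup norm. The whole line can be used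
because the convolution vanishes for `t ≤ 0`. -/
theorem exists_bounded_eq_add_volterraConv [CompleteSpace E] (hK : ContinuousOn K (Ioi 0))
    (hKint : IntegrableOn K (Ioi 0)) (hhalf : ∫ r in Ioi 0, ‖K r‖ ≤ 1 / 2)
    (w : BoundedContinuousFunction ℝ E) :
    ∃ v : BoundedContinuousFunction ℝ E, ∀ t, v t = w t + volterraConv K v t := by
  have hKloc : ∀ T, IntegrableOn K (Ioc 0 T) := fun T => hKint.mono_set Ioc_subset_Ioi_self
  let S : BoundedContinuousFunction ℝ E → BoundedContinuousFunction ℝ E := fun v =>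
    w + BoundedContinuousFunction.ofNormedAddCommGroup (volterraConv K v)
      (continuous_volterraConv hK hKloc v.continuous) _
      fun t => norm_volterraConv_le hKint (fun s _ => v.norm_coe_le_norm s) (norm_nonneg v)
  have hS : ContractingWith (1 / 2) S := by
    refine ⟨by norm_num, LipschitzWith.of_dist_le_mul fun v₁ v₂ => ?_⟩
    refine (BoundedContinuousFunction.dist_le (by positivity)).2 fun t => ?_
    have h1 : dist (S v₁ t) (S v₂ t) = ‖volterraConv K (fun s => v₁ s - v₂ s) t‖ := by
      rw [volterraConv_sub hK hKloc v₁.continuous v₂.continuous, dist_eq_norm]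
      simp [S]
    rw [h1]
    refine (norm_volterraConv_le hKint (C := dist v₁ v₂) (fun s _ => ?_) dist_nonneg).trans ?_
    · rw [← dist_eq_norm]
      exact BoundedContinuousFunction.dist_coe_le_dist s
    · refine mul_le_mul_of_nonneg_right (hhalf.trans (by simp)) dist_nonneg
  refine ⟨hS.fixedPoint, fun t => ?_⟩
  have := congrArg (fun v : BoundedContinuousFunction ℝ E => v t) hS.fixedPoint_isFixedPt
  exact this.symm

/-- At a maximum point `s` of `‖v‖` on `[0, T]` the equation gives `‖v s‖ ≤ ‖v s‖ / 2`. By causality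
only `[0, s]` matters, so no growth condition on `v` is needed. -/
theorem eq_zero_of_eq_volterraConv (hKint : IntegrableOn K (Ioi 0))
    (hhalf : ∫ r in Ioi 0, ‖K r‖ ≤ 1 / 2) {v : ℝ → E} (hv : Continuous v)
    (hvK : ∀ t, 0 ≤ t → v t = volterraConv K v t) {T : ℝ} (hT : 0 ≤ T) : v T = 0 := by
  obtain ⟨s, hs, hmax⟩ := (isCompact_Icc (a := (0 : ℝ)) (b := T)).exists_isMaxOn ⟨0, by simp [hT]⟩
    (f := fun t => ‖v t‖) (by fun_prop)
  have h1 := norm_volterraConv_le hKint (f := v) (t := s) (C := ‖v s‖)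
    (fun r hr => hmax ⟨hr.1, hr.2.trans hs.2⟩) (norm_nonneg _)
  rw [← hvK s hs.1] at h1
  have h2 : (∫ r in Ioi 0, ‖K r‖) * ‖v s‖ ≤ 1 / 2 * ‖v s‖ :=
    mul_le_mul_of_nonneg_right hhalf (norm_nonneg _)
  have h3 : ‖v T‖ ≤ ‖v s‖ := hmax (right_mem_Icc.2 hT)
  have h4 : ‖v s‖ ≤ 0 := by linarith
  exact norm_le_zero_iff.1 (h3.trans h4)

/-- Since `exp (-c t) = exp (-c r) * exp (-c (t - r))`, the weight can be moved onto both factors.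
-/
theorem volterraConv_exp_smul (c : ℝ) (f : ℝ → E) (t : ℝ) :
    volterraConv (fun r => Real.exp (-(c * r)) • K r) (fun s => Real.exp (-(c * s)) • f s) t =
      Real.exp (-(c * t)) • volterraConv K f t := by
  rw [volterraConv, volterraConv, ← integral_smul]
  congr 1 with r
  rw [smul_apply, map_smul, smul_smul, ← Real.exp_add]
  congr 2
  ring

variable {c : ℝ}

theorem integrableOn_Ioc_of_exp_smul (h : IntegrableOn (fun r => Real.exp (-(c * r)) • K r) (Ioi 0))
    (T : ℝ) : IntegrableOn K (Ioc 0 T) := by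
  have h1 : IntegrableOn (fun r => Real.exp (c * r) • (Real.exp (-(c * r)) • K r)) (Icc 0 T) := by
    refine IntegrableOn.continuousOn_smul ?_ (by fun_prop) isCompact_Icc
    rw [integrableOn_Icc_iff_integrableOn_Ioc]
    exact h.mono_set Ioc_subset_Ioi_self
  refine (h1.mono_set Ioc_subset_Icc_self).congr_fun (fun r _ => ?_) measurableSet_Ioc
  simp [smul_smul, ← Real.exp_add]

/-- Solvability of a Volterra equation of convolution type whose kernel is integrable with an
exponential weight. -/
theorem volterra_exists [CompleteSpace E] (hK : ContinuousOn K (Ioi 0)) (hc : 0 ≤ c)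
    (hKint : IntegrableOn (fun r => Real.exp (-(c * r)) • K r) (Ioi 0))
    (hhalf : ∫ r in Ioi 0, ‖Real.exp (-(c * r)) • K r‖ ≤ 1 / 2) (u₀ : E) :
    ∃ v : ℝ → E, Continuous v ∧ ∀ t, 0 ≤ t → v t = u₀ + volterraConv K v t := by
  have hcont : ContinuousOn (fun r => Real.exp (-(c * r)) • K r) (Ioi 0) :=
    ContinuousOn.smul (f := fun r => Real.exp (-(c * r))) (by fun_prop) hK
  let w : BoundedContinuousFunction ℝ E :=
    -- The `max` keeps the weighted datum bounded for negative times.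
    BoundedContinuousFunction.ofNormedAddCommGroup (fun t => Real.exp (-(c * max t 0)) • u₀)
      (by fun_prop) ‖u₀‖ fun t => by
        rw [norm_smul, Real.norm_of_nonneg (Real.exp_pos _).le]
        refine mul_le_of_le_one_left (norm_nonneg _) (Real.exp_le_one_iff.2 ?_)
        have : 0 ≤ c * max t 0 := by positivity
        linarith
  obtain ⟨v, hv⟩ := exists_bounded_eq_add_volterraConv hcont hKint hhalf w
  have hexp : ∀ t, Real.exp (-(c * t)) • (Real.exp (c * t) • v t) = v t := fun t => by
    simp [smul_smul, ← Real.exp_add]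
  refine ⟨fun t => Real.exp (c * t) • v t, by fun_prop, fun t ht => ?_⟩
  have h1 := volterraConv_exp_smul (K := K) c (fun t => Real.exp (c * t) • v t) t
  simp only [hexp] at h1
  have h2 := hv t
  rw [h1] at h2
  have h3 : w t = Real.exp (-(c * t)) • u₀ := by
    simp [w, max_eq_left ht]
  rw [h3, ← smul_add] at h2
  simp only
  rw [h2, smul_smul, ← Real.exp_add]
  simp

theorem volterra_unique (hK : ContinuousOn K (Ioi 0))
    (hKint : IntegrableOn (fun r => Real.exp (-(c * r)) • K r) (Ioi 0))
    (hhalf : ∫ r in Ioi 0, ‖Real.exp (-(c * r)) • K r‖ ≤ 1 / 2) {u₀ : E} {v₁ v₂ : ℝ → E}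
    (hv₁ : Continuous v₁) (hv₂ : Continuous v₂)
    (h₁ : ∀ t, 0 ≤ t → v₁ t = u₀ + volterraConv K v₁ t)
    (h₂ : ∀ t, 0 ≤ t → v₂ t = u₀ + volterraConv K v₂ t) {t : ℝ} (ht : 0 ≤ t) : v₁ t = v₂ t := by
  have h := eq_zero_of_eq_volterraConv hKint hhalf
    (v := fun s => Real.exp (-(c * s)) • (v₁ s - v₂ s)) (by fun_prop) (fun s hs => ?_) ht
  · rw [smul_eq_zero] at h
    exact sub_eq_zero.1 (h.resolve_left (Real.exp_pos _).ne')
  · rw [volterraConv_exp_smul c (fun s => v₁ s - v₂ s),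
      volterraConv_sub hK (integrableOn_Ioc_of_exp_smul hKint) hv₁ hv₂]
    congr 1
    nth_rw 1 [h₁ s hs, h₂ s hs]
    abel

end Volterra

/-! ### Weakly singular kernels under an exponential weight -/

section WeaklySingular

variable {E : Type*} [NormedAddCommGroup E] [NormedSpace ℝ E] {K : ℝ → E →L[ℝ] E}

theorem integrableOn_rpow_mul_exp_neg {a c : ℝ} (ha : 0 < a) (hc : 0 < c) :
    IntegrableOn (fun r : ℝ => r ^ (a - 1) * Real.exp (-(c * r))) (Ioi 0) := by
  by_contra h
  have h1 := Real.integral_rpow_mul_exp_neg_mul_Ioi ha hc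
  rw [integral_undef h] at h1
  have := Real.Gamma_pos_of_pos ha
  have h2 : 0 < (1 / c) ^ a * Real.Gamma a := by positivity
  exact h2.ne h1

/-- A weakly singular kernel is integrable with small norm against a large exponential weight. -/
theorem exists_exp_smul_integrableOn (hK : ContinuousOn K (Ioi 0)) {a C : ℝ} (ha : 0 < a)
    (hKC : ∀ r, 0 < r → ‖K r‖ ≤ C * (r ^ (a - 1) + 1)) :
    ∃ c : ℝ, 0 ≤ c ∧ IntegrableOn (fun r => Real.exp (-(c * r)) • K r) (Ioi 0) ∧
      ∫ r in Ioi 0, ‖Real.exp (-(c * r)) • K r‖ ≤ 1 / 2 := by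
  -- The Laplace transform of the bound `C (r ^ (a - 1) + 1)` at `c`; it tends to `0` as `c → ∞`.
  have hlim : Filter.Tendsto
      (fun c : ℝ => C * ((1 / c) ^ a * Real.Gamma a + (1 / c) ^ (1 : ℝ) * Real.Gamma 1))
      Filter.atTop (nhds (C * (0 * Real.Gamma a + 0 * Real.Gamma 1))) := by
    have key : ∀ b : ℝ, 0 < b → Filter.Tendsto (fun c : ℝ => (1 / c) ^ b) Filter.atTop (nhds 0) := by
      intro b hb
      refine (tendsto_rpow_neg_atTop hb).congr' ?_
      filter_upwards [Filter.eventually_gt_atTop 0] with c hc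
      rw [one_div, Real.inv_rpow hc.le, Real.rpow_neg hc.le]
    exact (((key a ha).mul_const _).add ((key 1 one_pos).mul_const _)).const_mul C
  have h0 : C * (0 * Real.Gamma a + 0 * Real.Gamma 1) < 1 / 2 := by norm_num
  obtain ⟨c, hc, hc0⟩ := ((hlim.eventually (gt_mem_nhds h0)).and
    (Filter.eventually_gt_atTop 0)).exists
  have hI : IntegrableOn (fun r : ℝ => C * (r ^ (a - 1) * Real.exp (-(c * r)) +
      r ^ ((1 : ℝ) - 1) * Real.exp (-(c * r)))) (Ioi 0) :=
    ((integrableOn_rpow_mul_exp_neg ha hc0).add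
      (integrableOn_rpow_mul_exp_neg one_pos hc0)).const_mul C
  have hle : ∀ r ∈ Ioi (0 : ℝ), ‖Real.exp (-(c * r)) • K r‖ ≤
      C * (r ^ (a - 1) * Real.exp (-(c * r)) + r ^ ((1 : ℝ) - 1) * Real.exp (-(c * r))) := by
    intro r hr
    rw [norm_smul, Real.norm_of_nonneg (Real.exp_pos _).le]
    refine (mul_le_mul_of_nonneg_left (hKC r hr) (Real.exp_pos _).le).trans (le_of_eq ?_)
    rw [sub_self, Real.rpow_zero]
    ring
  have hint : IntegrableOn (fun r => Real.exp (-(c * r)) • K r) (Ioi 0) := by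
    refine Integrable.mono' hI (ContinuousOn.aestronglyMeasurable
      (ContinuousOn.smul (f := fun r => Real.exp (-(c * r))) (by fun_prop) hK)
      measurableSet_Ioi) ?_
    filter_upwards [ae_restrict_mem measurableSet_Ioi] with r hr using hle r hr
  refine ⟨c, hc0.le, hint, ?_⟩
  refine (setIntegral_mono_on hint.norm hI measurableSet_Ioi hle).trans ?_
  rw [integral_const_mul, integral_add (integrableOn_rpow_mul_exp_neg ha hc0)
    (integrableOn_rpow_mul_exp_neg one_pos hc0), Real.integral_rpow_mul_exp_neg_mul_Ioi ha hc0,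
    Real.integral_rpow_mul_exp_neg_mul_Ioi one_pos hc0]
  exact hc.le

end WeaklySingular

/-! ### Multiplication by the Riemann-Liouville kernel of variable order -/

section Kernel

variable {a₀ : ℝ}

/-- The reciprocal of `Γ` is entire. -/
theorem continuous_inv_Gamma : Continuous fun a : ℝ => (Real.Gamma a)⁻¹ := by
  have h : (fun a : ℝ => (Real.Gamma a)⁻¹) = fun a : ℝ => ((Complex.Gamma a)⁻¹).re := by
    ext a
    rw [Complex.Gamma_ofReal, ← Complex.ofReal_inv, Complex.ofReal_re]
  rw [h]
  exact Complex.continuous_re.comp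
    (Complex.differentiable_one_div_Gamma.continuous.comp Complex.continuous_ofReal)

/-- The Riemann-Liouville kernel at a fixed positive time, as a continuous function of the order. -/
noncomputable def rlKernelMap (a₀ : ℝ) (r : ℝ) : C(Icc a₀ 1, ℝ) where
  -- Unlike `r ^ (a - 1)`, this form is continuous in `a` also for `r = 0`.
  toFun a := Real.exp (Real.log r * (a - 1)) * (Real.Gamma a)⁻¹
  continuous_toFun := Continuous.mul (by fun_prop) (continuous_inv_Gamma.comp continuous_subtype_val)

theorem rlKernelMap_apply {r : ℝ} (hr : 0 < r) (a : Icc a₀ 1) :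
    rlKernelMap a₀ r a = rlKernel a r := by
  rw [rlKernel_of_pos _ hr, Real.rpow_def_of_pos hr, div_eq_mul_inv]
  rfl

/-- Joint continuity in time and order yields continuity in the sup norm over orders, hence
operator-norm continuity of the multiplications on `L^p`. -/
theorem continuousOn_rlKernelMap : ContinuousOn (rlKernelMap a₀) (Ioi 0) := by
  rw [continuousOn_iff_continuous_domRestrict]
  refine ContinuousMap.continuous_of_continuous_uncurry _ ?_
  have h1 : Continuous fun z : Ioi (0 : ℝ) × Icc a₀ 1 => Real.log z.1 :=
    Continuous.log (by fun_prop) fun z => (mem_Ioi.1 z.1.2).ne'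
  have h2 : Continuous fun z : Ioi (0 : ℝ) × Icc a₀ 1 =>
      Real.exp (Real.log z.1 * ((z.2 : ℝ) - 1)) * (Real.Gamma z.2)⁻¹ :=
    Continuous.mul (by fun_prop) (continuous_inv_Gamma.comp (by fun_prop))
  exact h2

theorem exists_norm_rlKernelMap_le :
    ∃ C, 0 ≤ C ∧ ∀ r, 0 < r → ‖rlKernelMap a₀ r‖ ≤ C * (r ^ (a₀ - 1) + 1) := by
  let ψ : C(Icc a₀ 1, ℝ) := ⟨_, continuous_inv_Gamma.comp continuous_subtype_val⟩
  refine ⟨‖ψ‖, norm_nonneg _, fun r hr => ?_⟩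
  have hpos : 0 ≤ r ^ (a₀ - 1) := by positivity
  refine (ContinuousMap.norm_le _ (by positivity)).2 fun a => ?_
  have h1 : ‖(Real.Gamma a)⁻¹‖ ≤ ‖ψ‖ := ψ.norm_coe_le_norm a
  -- The first summand dominates for `r ≤ 1`, the second for `r ≥ 1`.
  have h2 : r ^ ((a : ℝ) - 1) ≤ r ^ (a₀ - 1) + 1 := by
    rcases le_total r 1 with h | h
    · have := Real.rpow_le_rpow_of_exponent_ge hr h (sub_le_sub_right a.2.1 1)
      linarith
    · have := Real.rpow_le_one_of_one_le_of_nonpos h (sub_nonpos.2 a.2.2)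
      linarith
  rw [rlKernelMap_apply hr, rlKernel_of_pos _ hr, div_eq_mul_inv, norm_mul, mul_comm,
    Real.norm_of_nonneg (by positivity : 0 ≤ r ^ ((a : ℝ) - 1))]
  exact mul_le_mul h1 h2 (by positivity) (norm_nonneg _)

theorem measurable_rlKernel_prod : Measurable fun z : ℝ × ℝ => rlKernel z.1 z.2 := by
  have h : (fun z : ℝ × ℝ => rlKernel z.1 z.2) = {z | 0 < z.2}.indicator
      fun z => z.2 ^ (z.1 - 1) * (Real.Gamma z.1)⁻¹ := by
    ext z
    by_cases hz : 0 < z.2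
    · rw [indicator_of_mem (show z ∈ {z : ℝ × ℝ | 0 < z.2} from hz),
        rlKernel_of_pos _ hz, div_eq_mul_inv]
    · rw [indicator_of_notMem (show z ∉ {z : ℝ × ℝ | 0 < z.2} from hz),
        rlKernel_of_nonpos _ (not_lt.1 hz)]
  rw [h]
  exact Measurable.indicator (Measurable.mul (by fun_prop)
    (continuous_inv_Gamma.measurable.comp measurable_fst))
    (measurableSet_lt measurable_const measurable_snd)

variable {X : Type*} [MeasurableSpace X] {μ : Measure X} {p : ℝ≥0∞} [Fact (1 ≤ p)]

theorem memLp_top_comp {α : X → Icc a₀ 1} (hα : Measurable α) (h : C(Icc a₀ 1, ℝ)) :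
    MemLp (fun x => h (α x)) ∞ μ :=
  memLp_top_of_bound (h.continuous.measurable.comp hα).aestronglyMeasurable ‖h‖
    (Filter.Eventually.of_forall fun _ => h.norm_coe_le_norm _)

/-- Composition with a measurable order function, as a map to `L^∞`. -/
noncomputable def compLpTop (μ : Measure X) {α : X → Icc a₀ 1} (hα : Measurable α) :
    C(Icc a₀ 1, ℝ) →L[ℝ] Lp ℝ ∞ μ :=
  LinearMap.mkContinuous
    { toFun := fun h => (memLp_top_comp hα h).toLp
      map_add' := fun h k => by rw [← MemLp.toLp_add]; rfl
      map_smul' := fun c h => by rw [RingHom.id_apply, ← MemLp.toLp_const_smul]; rfl } 1 fun h => by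
    rw [LinearMap.coe_mk, AddHom.coe_mk, Lp.norm_toLp, one_mul, eLpNorm_exponent_top]
    exact ENNReal.toReal_le_of_le_ofReal (norm_nonneg _) (eLpNormEssSup_le_of_ae_bound
      (Filter.Eventually.of_forall fun _ => h.norm_coe_le_norm _))

/-- Multiplication in `L^p` by a continuous function of the order. -/
noncomputable def mulLp (μ : Measure X) (p : ℝ≥0∞) [Fact (1 ≤ p)] {α : X → Icc a₀ 1}
    (hα : Measurable α) : C(Icc a₀ 1, ℝ) →L[ℝ] Lp ℝ p μ →L[ℝ] Lp ℝ p μ :=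
  ((ContinuousLinearMap.lsmul ℝ ℝ).holderL μ ∞ p p).comp (compLpTop μ hα)

theorem coeFn_mulLp {α : X → Icc a₀ 1} (hα : Measurable α) (h : C(Icc a₀ 1, ℝ)) (f : Lp ℝ p μ) :
    mulLp μ p hα h f =ᵐ[μ] fun x => h (α x) * f x := by
  have h1 := ContinuousLinearMap.coeFn_holder (r := p) (ContinuousLinearMap.lsmul ℝ ℝ)
    (compLpTop μ hα h) f
  have h2 : compLpTop μ hα h =ᵐ[μ] fun x => h (α x) := MemLp.coeFn_toLp (memLp_top_comp hα h)
  filter_upwards [h1, h2] with x hx1 hx2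
  rw [hx2] at hx1
  exact hx1

/-- The operator on `L^p` of multiplication by `r ^ (α x - 1) / Γ (α x)`. -/
noncomputable def rlOperator (μ : Measure X) (p : ℝ≥0∞) [Fact (1 ≤ p)]
    {α : X → Icc a₀ 1} (hα : Measurable α) (r : ℝ) : Lp ℝ p μ →L[ℝ] Lp ℝ p μ :=
  mulLp μ p hα (rlKernelMap a₀ r)

theorem continuousOn_rlOperator {α : X → Icc a₀ 1} (hα : Measurable α) :
    ContinuousOn (rlOperator μ p hα) (Ioi 0) :=
  (mulLp μ p hα).continuous.comp_continuousOn continuousOn_rlKernelMap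

theorem exists_norm_rlOperator_le {α : X → Icc a₀ 1} (hα : Measurable α) :
    ∃ C, 0 ≤ C ∧ ∀ r, 0 < r → ‖rlOperator μ p hα r‖ ≤ C * (r ^ (a₀ - 1) + 1) := by
  obtain ⟨C, hC0, hC⟩ := exists_norm_rlKernelMap_le
  refine ⟨‖mulLp μ p hα‖ * C, by positivity, fun r hr => ?_⟩
  refine ((mulLp μ p hα).le_opNorm _).trans ?_
  rw [mul_assoc]
  exact mul_le_mul_of_nonneg_left (hC r hr) (norm_nonneg _)

theorem coeFn_rlOperator {α : X → Icc a₀ 1} (hα : Measurable α) {r : ℝ}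
    (hr : 0 < r) (f : Lp ℝ p μ) :
    rlOperator μ p hα r f =ᵐ[μ] fun x => rlKernel (α x) r * f x := by
  filter_upwards [coeFn_mulLp hα (rlKernelMap a₀ r) f] with x hx
  rw [← rlKernelMap_apply hr, ← hx]
  rfl

theorem integrableOn_rlOperator (ha₀ : 0 < a₀) {α : X → Icc a₀ 1} (hα : Measurable α) (T : ℝ) :
    IntegrableOn (rlOperator μ p hα) (Ioc 0 T) := by
  obtain ⟨C, -, hC⟩ := exists_norm_rlOperator_le (μ := μ) (p := p) hα
  obtain ⟨c, -, hc, -⟩ := exists_exp_smul_integrableOn (continuousOn_rlOperator hα) ha₀ hC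
  exact integrableOn_Ioc_of_exp_smul hc T

/-- The convolution with the multiplication operators is computed pointwise by the
Riemann-Liouville integral of a jointly measurable representative. -/
theorem volterraConv_rlOperator_ae_eq [SigmaFinite μ] (ha₀ : 0 < a₀) {α : X → Icc a₀ 1}
    (hα : Measurable α) {g : ℝ → Lp ℝ p μ} (hg : Continuous g) {γ : ℝ → X → ℝ}
    (hγ : Measurable (Function.uncurry γ)) (hγg : ∀ t, γ t =ᵐ[μ] g t) {t : ℝ} (ht : 0 ≤ t) :
    ∀ᵐ x ∂μ, volterraConv (rlOperator μ p hα) g t x =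
      rlInt (α x) (fun s => γ s x) t := by
  have hmeas : Measurable (Function.uncurry fun r x => rlKernel (α x) r * γ (t - r) x) := by
    refine Measurable.mul ?_ ?_
    · exact measurable_rlKernel_prod.comp
        ((hα.comp measurable_snd).subtype_val.prodMk measurable_fst)
    · exact hγ.comp ((measurable_const.sub measurable_fst).prodMk measurable_snd)
  have h := integral_Lp_ae_eq (integrableOn_volterra (continuousOn_rlOperator hα)
    (integrableOn_rlOperator ha₀ hα) hg t) hmeas (by
      filter_upwards [ae_restrict_mem measurableSet_Ioc] with r hr
      filter_upwards [coeFn_rlOperator hα hr.1 (g (t - r)), hγg (t - r)] with x h1 h2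
      rw [h1, h2])
  filter_upwards [h] with x hx
  rw [volterraConv, hx.2, ← intervalIntegral.integral_of_le ht, rlInt]
  simpa using intervalIntegral.integral_comp_sub_left (a := 0) (b := t)
    (fun s => rlKernel (α x) (t - s) * γ s x) t

end Kernel

/-! ### Equivalence of the Cauchy problem with a Volterra equation -/

/-- A domain of integration independent of `t` makes joint measurability a statement about parameter
integrals. -/
theorem rlInt_eq_integral_Ioi (a : ℝ) (f : ℝ → ℝ) (t : ℝ) :
    rlInt a f t = ∫ s in Ioi 0, rlKernel a (t - s) * f s := by
  rcases le_total 0 t with ht | ht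
  · rw [rlInt, intervalIntegral.integral_of_le ht]
    refine (setIntegral_eq_of_subset_of_forall_sdiff_eq_zero measurableSet_Ioi
      Ioc_subset_Ioi_self fun s hs => ?_).symm
    have : t ≤ s := not_lt.1 fun h => hs.2 ⟨hs.1, h.le⟩
    rw [rlKernel_of_nonpos _ (sub_nonpos.2 this), zero_mul]
  · rw [rlInt, intervalIntegral.integral_of_ge ht, setIntegral_eq_zero_of_forall_eq_zero,
      setIntegral_eq_zero_of_forall_eq_zero, neg_zero]
    · intro s hs
      rw [rlKernel_of_nonpos _ (by linarith [mem_Ioi.1 hs]), zero_mul]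
    · intro s hs
      rw [rlKernel_of_nonpos _ (by linarith [hs.1]), zero_mul]

theorem rlInt_zero_right (a : ℝ) (f : ℝ → ℝ) : rlInt a f 0 = 0 := by
  simp [rlInt]

theorem rlInt_congr_ae {a T : ℝ} (hT : 0 ≤ T) {f g : ℝ → ℝ}
    (h : ∀ᵐ s ∂volume.restrict (Ioc 0 T), f s = g s) : rlInt a f T = rlInt a g T := by
  rw [rlInt, rlInt, intervalIntegral.integral_of_le hT, intervalIntegral.integral_of_le hT]
  refine integral_congr_ae ?_
  filter_upwards [h] with s hs
  rw [hs]

theorem measurable_rlInt {X : Type*} [MeasurableSpace X] {β : X → ℝ} (hβ : Measurable β)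
    {γ : ℝ → X → ℝ} (hγ : Measurable (Function.uncurry γ)) :
    Measurable (Function.uncurry fun t x => rlInt (β x) (fun s => γ s x) t) := by
  simp only [rlInt_eq_integral_Ioi]
  have h : Measurable fun z : (ℝ × X) × ℝ => rlKernel (β z.1.2) (z.1.1 - z.2) * γ z.2 z.1.2 := by
    have h1 : Measurable fun z : (ℝ × X) × ℝ => (β z.1.2, z.1.1 - z.2) := by fun_prop
    have h2 : Measurable fun z : (ℝ × X) × ℝ => (z.2, z.1.2) := by fun_prop
    have h3 : Measurable fun z : (ℝ × X) × ℝ => rlKernel (β z.1.2) (z.1.1 - z.2) :=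
      measurable_rlKernel_prod.comp h1
    have h4 : Measurable fun z : (ℝ × X) × ℝ => γ z.2 z.1.2 := hγ.comp h2
    exact h3.mul h4
  exact (h.stronglyMeasurable.integral_prod_right' (ν := volume.restrict (Ioi 0))).measurable

section Pointwise

variable {X : Type*} {β : X → ℝ} {w : ℝ → X → ℝ} {t : ℝ} {x : X}

theorem rlIntegral_of_ne_zero (hβ : β x ≠ 0) (ht : 0 ≤ t) :
    rlIntegral β w t x = rlInt (β x) (fun s => w s x) t := by
  rw [rlIntegral, if_neg hβ, rlInt, ← intervalIntegral.integral_const_mul,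
    intervalIntegral.integral_of_le ht, intervalIntegral.integral_of_le ht,
    integral_Ioc_eq_integral_Ioo, integral_Ioc_eq_integral_Ioo]
  refine setIntegral_congr_fun measurableSet_Ioo fun s hs => ?_
  rw [rlKernel_of_pos _ (sub_pos.2 hs.2)]
  ring

theorem rlIntegralExists_of_intervalIntegrable (hβ : 0 < β x) (ht : 0 ≤ t)
    (h : IntervalIntegrable (fun s => rlKernel (β x) (t - s) * w s x) volume 0 t) :
    RLIntegralExists β w t x := by
  refine Or.inr ?_
  rw [intervalIntegrable_iff_integrableOn_Ioo_of_le ht] at h ⊢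
  refine (Integrable.const_mul h (Real.Gamma (β x))).congr ?_
  filter_upwards [ae_restrict_mem measurableSet_Ioo] with s hs
  have := (Real.Gamma_pos_of_pos hβ).ne'
  rw [rlKernel_of_pos _ (sub_pos.2 hs.2)]
  field_simp

end Pointwise

theorem HasCaputoDeriv.congr_order {X : Type*} [MeasurableSpace X] {μ : Measure X} {p : ℝ≥0∞}
    [Fact (1 ≤ p)] {α β : X → ℝ} {u f : ℝ≥0 → Lp ℝ p μ} (hαβ : α =ᵐ[μ] β)
    (h : HasCaputoDeriv α u f) : HasCaputoDeriv β u f := by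
  obtain ⟨φ, V, hφ, hV, hderiv⟩ := h
  refine ⟨φ, V, hφ, fun t => ?_, hderiv⟩
  filter_upwards [hV t, hαβ] with x hx hαβx
  simpa only [RLIntegralExists, rlIntegral, hαβx] using hx

/-! ### The two implications and unique solvability -/

section Mild

variable {X : Type*} [MeasurableSpace X] {μ : Measure X} [SigmaFinite μ] {p : ℝ≥0∞}
  [Fact (1 ≤ p)] {a₀ : ℝ} {α : X → Icc a₀ 1} (hα : Measurable α)
  {A : Lp ℝ p μ →L[ℝ] Lp ℝ p μ} {u₀ : Lp ℝ p μ}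

/-- A continuous solution of the Volterra equation solves the Cauchy problem. -/
theorem hasCaputoDeriv_of_volterra (ha₀ : 0 < a₀) {v : ℝ → Lp ℝ p μ} (hv : Continuous v)
    (hvK : ∀ t, 0 ≤ t →
      v t = u₀ + volterraConv (rlOperator μ p hα) (fun s => A (v s)) t) :
    HasCaputoDeriv (fun x => (α x : ℝ)) (fun t : ℝ≥0 => v t) (fun t : ℝ≥0 => A (v t)) := by
  have hg : Continuous fun s => A (v s) := by fun_prop
  obtain ⟨γ, hγ, hγg⟩ := exists_measurable_representative hg
  -- With this representative, `φ s x - φ 0 x` equals `J^α γ` for every `s` and `x`, not merely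
  -- almost everywhere.
  refine ⟨fun t x => u₀ x + rlInt (α x) (fun s => γ s x) t, fun t => ∫ s in (0 : ℝ)..t, A (v s),
    ⟨?_, fun t => ?_⟩, fun t => ?_, fun t => ?_⟩
  · exact ((Lp.stronglyMeasurable u₀).measurable.comp measurable_snd).add
      (measurable_rlInt hα.subtype_val hγ)
  · change (fun x => u₀ x + rlInt (α x) (fun s => γ s x) t) =ᵐ[μ] v t
    rw [hvK t t.coe_nonneg]
    filter_upwards [Lp.coeFn_add u₀ (volterraConv (rlOperator μ p hα) (fun s => A (v s)) t),
      volterraConv_rlOperator_ae_eq ha₀ hα hg hγ hγg t.coe_nonneg] with x h1 h2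
    rw [h1, Pi.add_apply, h2]
  · have h := integral_Lp_ae_eq (ν := volume.restrict (Ioc 0 (t : ℝ)))
      (hg.integrableOn_Icc.mono_set Ioc_subset_Icc_self) hγ (Filter.Eventually.of_forall hγg)
    filter_upwards [h] with x hx
    have hγx : IntervalIntegrable (fun s => γ s x) volume 0 t :=
      (intervalIntegrable_iff_integrableOn_Ioc_of_le t.coe_nonneg).2 hx.1
    have hw : ∀ s, u₀ x + rlInt (α x) (fun r => γ r x) s -
        (u₀ x + rlInt (α x) (fun r => γ r x) 0) = rlInt (α x) (fun r => γ r x) s := by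
      intro s
      simp [rlInt_zero_right]
    rw [intervalIntegral.integral_of_le t.coe_nonneg, hx.2,
      ← intervalIntegral.integral_of_le t.coe_nonneg, ← rlInt_one _ t.coe_nonneg]
    rcases eq_or_ne (α x : ℝ) 1 with h1 | h1
    · have h0 : 1 - (α x : ℝ) = 0 := by rw [h1, sub_self]
      refine ⟨Or.inl h0, ?_⟩
      rw [rlIntegral, if_pos h0, hw, h1]
    · have h0 : 0 < 1 - (α x : ℝ) := sub_pos.2 (lt_of_le_of_ne (α x).2.2 h1)
      obtain ⟨h2, h3⟩ := rlInt_rlInt h0 (ha₀.trans_le (α x).2.1)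
        (by rw [sub_add_cancel]) t.coe_nonneg hγx
      constructor
      · refine rlIntegralExists_of_intervalIntegrable h0 t.coe_nonneg ?_
        simpa only [hw] using h2
      · rw [rlIntegral_of_ne_zero (β := fun y => 1 - (α y : ℝ)) h0.ne' t.coe_nonneg]
        simp only [hw]
        rw [h3, sub_add_cancel]
  · exact (intervalIntegral.integral_hasDerivAt_right (hg.intervalIntegrable _ _)
      (hg.stronglyMeasurableAtFilter _ _) hg.continuousAt).hasDerivWithinAt

open Classical in
/-- The fractional integral of order `α x` inverts the one of order `1 - α x` up to integration. -/
theorem integral_eq_integral_rlInt {a T : ℝ} (ha : 0 < a) (ha1 : a ≤ 1) (hT : 0 ≤ T)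
    {w γ : ℝ → ℝ} (hw : IntervalIntegrable w volume 0 T) (hγ : IntervalIntegrable γ volume 0 T)
    (h : ∀ᵐ s ∂volume.restrict (Ioc 0 T),
      (if a = 1 then w s else rlInt (1 - a) w s) = rlInt 1 γ s) :
    ∫ s in (0 : ℝ)..T, w s = ∫ s in (0 : ℝ)..T, rlInt a γ s := by
  rcases eq_or_ne a 1 with rfl | h1
  · simp only [if_true] at h
    rw [intervalIntegral.integral_of_le hT, intervalIntegral.integral_of_le hT]
    exact integral_congr_ae h
  · simp only [if_neg h1] at h
    have h0 : 0 < 1 - a := sub_pos.2 (lt_of_le_of_ne ha1 h1)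
    have e1 := (rlInt_rlInt ha h0 (by simp) hT hw).2
    have e2 := (rlInt_rlInt ha one_pos (by linarith) hT hγ).2
    have e3 := (rlInt_rlInt one_pos ha (by linarith) hT hγ).2
    rw [add_sub_cancel] at e1
    -- `J^1 w = J^a J^(1-a) w = J^a J^1 γ = J^(a+1) γ = J^1 J^a γ`.
    rw [← rlInt_one _ hT, ← rlInt_one _ hT, ← e1, rlInt_congr_ae hT h, e2, e3, add_comm]

open Classical in
/-- The primitives of `u - u(0)` and of the right-hand side of the Volterra equation agree. -/
theorem integral_eq_of_hasCaputoDeriv (ha₀ : 0 < a₀) {u : ℝ → Lp ℝ p μ} (hu : Continuous u)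
    (h : HasCaputoDeriv (fun x => (α x : ℝ)) (fun t : ℝ≥0 => u t) (fun t : ℝ≥0 => A (u t)))
    {T : ℝ} (hT : 0 ≤ T) :
    ∫ s in (0 : ℝ)..T, (u s - u 0) =
      ∫ s in (0 : ℝ)..T, volterraConv (rlOperator μ p hα) (fun s => A (u s)) s := by
  obtain ⟨φ, V, ⟨hφ, hφu⟩, hV, hderiv⟩ := h
  have hg : Continuous fun s => A (u s) := by fun_prop
  have hφu' : ∀ t : ℝ, 0 ≤ t → φ t =ᵐ[μ] u t := fun t ht => hφu ⟨t, ht⟩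
  have hV' : ∀ t : ℝ, 0 ≤ t → ∀ᵐ x ∂μ,
      V t x = rlIntegral (fun y => 1 - (α y : ℝ)) (fun s y => φ s y - φ 0 y) t x :=
    fun t ht => (hV ⟨t, ht⟩).mono fun _ hx => hx.2
  obtain ⟨γ, hγ, hγg⟩ := exists_measurable_representative hg
  have hγint : ∀ t : ℝ, 0 ≤ t → ∀ᵐ x ∂μ, IntervalIntegrable (fun s => γ s x) volume 0 t ∧
      (∫ s in (0 : ℝ)..t, A (u s) : Lp ℝ p μ) x = ∫ s in (0 : ℝ)..t, γ s x := by
    intro t ht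
    filter_upwards [integral_Lp_ae_eq (ν := volume.restrict (Ioc 0 t))
      (hg.integrableOn_Icc.mono_set Ioc_subset_Icc_self) hγ
      (Filter.Eventually.of_forall hγg)] with x hx
    rw [intervalIntegral.integral_of_le ht, intervalIntegral.integral_of_le ht]
    exact ⟨(intervalIntegrable_iff_integrableOn_Ioc_of_le ht).2 hx.1, hx.2⟩
  have hV0 : V 0 = 0 := by
    rw [Lp.eq_zero_iff_ae_eq_zero]
    filter_upwards [hV' 0 le_rfl] with x hx
    rw [hx, rlIntegral]
    simp
  have hVint : ∀ t : ℝ, 0 ≤ t → V t = ∫ s in (0 : ℝ)..t, A (u s) := by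
    intro t ht
    have hd : ∀ s : ℝ, 0 ≤ s → HasDerivWithinAt V (A (u s)) (Ici 0) s :=
      fun s hs => hderiv ⟨s, hs⟩
    rw [intervalIntegral.integral_eq_sub_of_hasDeriv_right_of_le ht
      (fun s hs => ((hd s hs.1).continuousWithinAt).mono Icc_subset_Ici_self)
      (fun s hs => (hd s hs.1.le).mono fun r hr => hs.1.le.trans (le_of_lt hr))
      (hg.intervalIntegrable _ _), hV0, sub_zero]
  have hwmeas : Measurable (Function.uncurry fun s x => φ s x - φ 0 x) :=
    hφ.sub (hφ.comp (measurable_const.prodMk measurable_snd))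
  have hαm : Measurable fun x => (α x : ℝ) := hα.subtype_val
  -- The exceptional set of `x` depends on `s`; joint measurability allows the quantifiers to be
  -- exchanged.
  have hswap : ∀ᵐ x ∂μ, ∀ᵐ s ∂volume.restrict (Ioc 0 T),
      (if (α x : ℝ) = 1 then φ s x - φ 0 x
        else rlInt (1 - α x) (fun r => φ r x - φ 0 x) s) = rlInt 1 (fun r => γ r x) s := by
    refine (Measure.ae_ae_comm ?_).1 ?_
    · refine measurableSet_eq_fun (Measurable.ite ?_ hwmeas
        (measurable_rlInt (measurable_const.sub hαm) hwmeas)) (measurable_rlInt measurable_const hγ)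
      exact measurableSet_eq_fun (hαm.comp measurable_snd) measurable_const
    · filter_upwards [ae_restrict_mem measurableSet_Ioc] with s hs
      filter_upwards [hV' s hs.1.le, hγint s hs.1.le] with x hx hx2
      rw [hVint s hs.1.le, hx2.2] at hx
      rw [rlInt_one _ hs.1.le, hx]
      by_cases h1 : (α x : ℝ) = 1
      · rw [if_pos h1, rlIntegral, if_pos (by rw [h1, sub_self])]
      · rw [if_neg h1, rlIntegral_of_ne_zero (β := fun y => 1 - (α y : ℝ))
          (sub_ne_zero.2 fun h => h1 h.symm) hs.1.le]
  have hL := integral_Lp_ae_eq (ν := volume.restrict (Ioc 0 T)) (G := fun s => u s - u 0)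
    ((by fun_prop : Continuous fun s => u s - u 0).integrableOn_Icc.mono_set Ioc_subset_Icc_self)
    hwmeas (by
      filter_upwards [ae_restrict_mem measurableSet_Ioc] with s hs
      filter_upwards [hφu' s hs.1.le, hφu' 0 le_rfl, Lp.coeFn_sub (u s) (u 0)] with x h1 h2 h3
      rw [h3, Pi.sub_apply, h1, h2])
  have hcont : Continuous (volterraConv (rlOperator μ p hα) fun s => A (u s)) :=
    continuous_volterraConv (continuousOn_rlOperator hα) (integrableOn_rlOperator ha₀ hα) hg
  have hR := integral_Lp_ae_eq (ν := volume.restrict (Ioc 0 T))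
    (hcont.integrableOn_Icc.mono_set Ioc_subset_Icc_self) (measurable_rlInt hαm hγ) (by
      filter_upwards [ae_restrict_mem measurableSet_Ioc] with s hs
      filter_upwards [volterraConv_rlOperator_ae_eq ha₀ hα hg hγ hγg hs.1.le] with x hx
      exact hx.symm)
  refine Lp.ext ?_
  filter_upwards [hL, hR, hγint T hT, hswap] with x h1 h2 h3 h4
  rw [intervalIntegral.integral_of_le hT, intervalIntegral.integral_of_le hT, h1.2, h2.2,
    ← intervalIntegral.integral_of_le hT, ← intervalIntegral.integral_of_le hT]
  exact integral_eq_integral_rlInt (ha₀.trans_le (α x).2.1) (α x).2.2 hT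
    ((intervalIntegrable_iff_integrableOn_Ioc_of_le hT).2 h1.1) h3.1 h4

/-- A solution of the Cauchy problem solves the Volterra equation. -/
theorem eq_add_volterraConv_of_hasCaputoDeriv (ha₀ : 0 < a₀) {u : ℝ → Lp ℝ p μ} (hu : Continuous u)
    (h : HasCaputoDeriv (fun x => (α x : ℝ)) (fun t : ℝ≥0 => u t) (fun t : ℝ≥0 => A (u t)))
    {t : ℝ} (ht : 0 ≤ t) :
    u t = u 0 + volterraConv (rlOperator μ p hα) (fun s => A (u s)) t := by
  have hg : Continuous fun s => A (u s) := by fun_prop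
  have hcont : Continuous (volterraConv (rlOperator μ p hα) fun s => A (u s)) :=
    continuous_volterraConv (continuousOn_rlOperator hα) (integrableOn_rlOperator ha₀ hα) hg
  have hcont' : Continuous fun s => u s - u 0 := by fun_prop
  have h1 : HasDerivWithinAt (fun t => ∫ s in (0 : ℝ)..t, (u s - u 0)) (u t - u 0) (Ici 0) t :=
    (intervalIntegral.integral_hasDerivAt_right (hcont'.intervalIntegrable _ _)
      (hcont'.stronglyMeasurableAtFilter _ _) hcont'.continuousAt).hasDerivWithinAt
  have h2 := (intervalIntegral.integral_hasDerivAt_right (hcont.intervalIntegrable 0 t)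
      (hcont.stronglyMeasurableAtFilter _ _) hcont.continuousAt).hasDerivWithinAt (s := Ici 0)
  have h3 := h2.congr (fun s hs => integral_eq_of_hasCaputoDeriv hα ha₀ hu h hs)
    (integral_eq_of_hasCaputoDeriv hα ha₀ hu h ht)
  -- The primitives agree on `[0, ∞)` and have continuous integrands, so the integrands agree, at
  -- `0` by the one-sided derivative.
  exact sub_eq_iff_eq_add'.1 ((uniqueDiffOn_Ici (0 : ℝ) t ht).eq_deriv _ h1 h3)

/-- Unique solvability of the Cauchy problem for a measurable order with values in `[a₀, 1]`. -/
theorem existsUnique_isSolution {a₀ : ℝ} (ha₀ : 0 < a₀) {α : X → Icc a₀ 1} (hα : Measurable α)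
    (A : Lp ℝ p μ →L[ℝ] Lp ℝ p μ) (u₀ : Lp ℝ p μ) :
    ∃! u : C(ℝ≥0, Lp ℝ p μ), IsSolution (fun x => (α x : ℝ)) A u₀ u := by
  -- Absorbing `A` into the kernel gives by definition the same convolution as applying it to the
  -- function.
  have hK : ContinuousOn (fun r => (rlOperator μ p hα r).comp A) (Ioi 0) :=
    (continuousOn_rlOperator hα).clm_comp continuousOn_const
  obtain ⟨C, -, hC⟩ := exists_norm_rlOperator_le (μ := μ) (p := p) hα
  obtain ⟨c, hc, hint, hhalf⟩ := exists_exp_smul_integrableOn hK (C := C * ‖A‖) ha₀ fun r hr => by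
    refine (ContinuousLinearMap.opNorm_comp_le _ _).trans ?_
    rw [mul_right_comm]
    exact mul_le_mul_of_nonneg_right (hC r hr) (norm_nonneg _)
  obtain ⟨v, hv, hvK⟩ := volterra_exists hK hc hint hhalf u₀
  refine ⟨⟨fun t : ℝ≥0 => v t, by fun_prop⟩, ⟨hasCaputoDeriv_of_volterra hα ha₀ hv hvK, ?_⟩, ?_⟩
  · simpa [volterraConv] using hvK 0 le_rfl
  · rintro u ⟨hu, hu0⟩
    ext1 t
    -- Negative times receive the constant value `u 0`.
    have hu' : Continuous fun s : ℝ => u s.toNNReal := by fun_prop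
    have key := volterra_unique hK hint hhalf (u₀ := u₀) hu' hv (fun s hs => ?_) hvK t.coe_nonneg
    · simpa using key
    · have := eq_add_volterraConv_of_hasCaputoDeriv hα ha₀ (A := A) hu' (by simpa using hu) hs
      rw [Real.toNNReal_zero, hu0] at this
      exact this

end Mild

end VariableOrder

/-! ### Orders bounded only almost everywhere -/

theorem theorem3p2 (n : ℕ) (Ω : Set (EuclideanSpace ℝ (Fin n))) (hΩ : IsOpen Ω)
    (p : ℝ≥0∞) [Fact (1 ≤ p)]
    (A : Lp ℝ p (volume.restrict Ω) →L[ℝ] Lp ℝ p (volume.restrict Ω))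
    (α₀ : ℝ) (hα₀ : 0 < α₀)
    (α : EuclideanSpace ℝ (Fin n) → ℝ) (hα : MemLp α ∞ (volume.restrict Ω))
    (hα_mem : ∀ᵐ x ∂(volume.restrict Ω), α x ∈ Icc α₀ 1)
    (u₀ : Lp ℝ p (volume.restrict Ω)) :
    ∃! u : C(ℝ≥0, Lp ℝ p (volume.restrict Ω)), VariableOrder.IsSolution α A u₀ u := by
  have hm : Measurable (hα.1.mk α) := hα.1.stronglyMeasurable_mk.measurable
  -- A measurable representative is clamped to an interval. The `min` keeps it nonempty when `α₀ >
  -- 1`, which can occur only if `Ω` is null.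
  have hβ : Measurable fun x => projIcc (min α₀ 1) 1 (min_le_right _ _) (hα.1.mk α x) :=
    continuous_projIcc.measurable.comp hm
  have hαβ : α =ᵐ[volume.restrict Ω]
      fun x => (projIcc (min α₀ 1) 1 (min_le_right _ _) (hα.1.mk α x) : ℝ) := by
    filter_upwards [hα.1.ae_eq_mk, hα_mem] with x h1 h2
    rw [← h1, projIcc_of_mem _ ⟨(min_le_left _ _).trans h2.1, h2.2⟩]
  obtain ⟨u, hu, huniq⟩ :=
    VariableOrder.existsUnique_isSolution (lt_min hα₀ one_pos) hβ A u₀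
  exact ⟨u, ⟨hu.1.congr_order hαβ.symm, hu.2⟩,
    fun v hv => huniq v ⟨hv.1.congr_order hαβ, hv.2⟩⟩
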